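/- Let $\rho>0$ and $\sigma>0$. Consider an $M/M/\infty$ queue with arrival rate $\rho$ and unit service rate that is empty at time $0$: the interarrival times are $\mathrm{Exp}(\rho)$, the service times are $\mathrm{Exp}(1)$, every customer is served from the moment of arrival, and all these random variables are independent. Let an observer stay in the system from time $0$ for an exponentially distributed time $T$ with mean $1/\sigma$, independent of the queue, and let $\mathfrak{d}(\sigma)$ be the number of customers who have departed from the queue by time $T$. Then $\mathfrak{d}(\sigma)$ is almost surely finite and, for every complex $z$ with $\rho|z|<\sigma+\rho$ (in particular for $|z|\le 1$), the random variable $z^{\mathfrak{d}(\sigma)}$ is integrable and $$ \mathbb{E}\left(z^{\mathfrak{d}(\sigma)}\right) =\sigma\sum_{n=0}^\infty\frac{(\sigma+n)^n e^{-(\sigma+n)}}{n!}\,\frac{1}{\sigma+\rho+n-\rho z} =\frac{\sigma}{\sigma+\rho(1-z)}\,\Phi\bigl(1,\sigma+\rho(1-z)+1;\rho(1-z)\bigr), $$ where the series converges absolutely and $\Phi(\alpha,\beta;z)=\sum_{n=0}^\infty\frac{(\alpha)_n}{(\beta)_n}\frac{z^n}{n!}$, with $(x)_n=x(x+1)\cdots(x+n-1)$,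 is the Kummer function. -/

import Mathlib

open MeasureTheory ProbabilityTheory

noncomputable section

/-- The Kummer function `Φ(α, β; z) = ∑ (α)_n / (β)_n * z ^ n / n!`, where `(x)_n` is the rising
factorial `x (x + 1) ⋯ (x + n - 1)`. -/
def kummerPhi (α β z : ℂ) : ℂ :=
  ∑' n : ℕ, (ascPochhammer ℂ n).eval α / (ascPochhammer ℂ n).eval β * (z ^ n / (n.factorial : ℂ))

/-- The primitive random variables of an initially empty `M/M/∞` queue, together with an observer:
the interarrival times, the service times of the successive customers, and the time at which the
observer leaves. -/
inductive QueueIndex : Type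
  | interarrival (i : ℕ)
  | service (i : ℕ)
  | observer

/-- The rates of these exponential random variables: arrival rate `ρ`, unit service rate, and
rate `σ` for the observation time. -/
def queueRate (ρ σ : ℝ) : QueueIndex → ℝ
  | .interarrival _ => ρ
  | .service _ => 1
  | .observer => σ

/-- `X` realizes, on the probability space `(Ω, P)`, an `M/M/∞` queue with arrival rate `ρ` and unit
service rate that is empty at time `0`, and an independent observer who stays for an exponential
time with mean `1 / σ`: all the interarrival times, all the service times and the observation time
are mutually independent and exponentially distributed with the respective rates. -/
structure IsObservedMMInfinity {Ω : Type*} [MeasurableSpace Ω] (P : Measure Ω) (ρ σ : ℝ)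
    (X : QueueIndex → Ω → ℝ) : Prop where
  measurable : ∀ j, Measurable (X j)
  law : ∀ j, P.map (X j) = expMeasure (queueRate ρ σ j)
  indep : iIndepFun X P

variable {Ω : Type*}

/-- The time at which customer `i` (`i = 0, 1, 2, …`) arrives. -/
def arrivalTime (X : QueueIndex → Ω → ℝ) (i : ℕ) (ω : Ω) : ℝ :=
  ∑ j ∈ Finset.range (i + 1), X (.interarrival j) ω

/-- The time at which customer `i` departs. There are infinitely many servers, so the service
starts upon arrival. -/
def departureTime (X : QueueIndex → Ω → ℝ) (i : ℕ) (ω : Ω) : ℝ :=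
  arrivalTime X i ω + X (.service i) ω

/-- The set of the customers who have departed by time `t`. -/
def departedBy (X : QueueIndex → Ω → ℝ) (t : ℝ) (ω : Ω) : Set ℕ :=
  {i | departureTime X i ω ≤ t}

/-- The number `D(t)` of departures from the queue up to time `t`. -/
def numDepartures (X : QueueIndex → Ω → ℝ) (t : ℝ) (ω : Ω) : ℕ :=
  (departedBy X t ω).ncard

/-- The number `𝔡(σ)` of departures from the queue while the observer is in the system. -/
def observedDepartures (X : QueueIndex → Ω → ℝ) (ω : Ω) : ℕ :=
  numDepartures X (X .observer ω) ω

end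

/-!
Write `h(t) = t - 1 + exp (-t)` (`integratedServiceCdf`) and `a = ρ (1 - z)`. The number of
departures by time `t` is Poisson with mean `ρ h(t)`, so that the generating function of the number
of departures seen by the observer is
`σ ∫ exp (-(σ t) - a h(t)) dt` over `t > 0`. The proof establishes this formula and evaluates the
integral in two ways.

*The formula.* No Poisson process is constructed. The expectation of `z ^ 𝔡(σ)` is split according
to the number `n` of arrivals before the observer leaves at time `T`; on that event `z ^ 𝔡(σ)` is a
product of `n` factors `z` or `1`. Customers are removed from this product starting with the last
one: the service time, and then the interarrival time, of that customer is independent of everything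
that remains, and integrating it out leaves a function of the residual time `r` of the observer at
the previous arrival (`integral_departureWeight_succ_mul_poissonWeight`). The functions that arise
are the explicit `poissonWeight ρ z k r = exp (-(ρ r)) (ρ Q(r)) ^ k / k!`, where
`Q(r) = r + (z - 1) h(r)`: they satisfy the renewal equation
`integral_expMeasure_mul_poissonWeight`. When all `n` customers are removed, only the integral over
the law of `T` is left (`integral_exactWeight`), and the sum over `n` is an exponential series. Since
the same formula for `‖z‖` computes the `L¹` norms, it also justifies the interchange of sum and
expectation. For `z = 1` the sum is `1`, which shows that almost surely only finitely many customers
arrive before `T`.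

*The series.* For `0 < u < 1`,
`∑ (σ + n) ^ n / n! (u exp (-u)) ^ n = exp (σ u) / (1 - u)` (`hasSum_abel`). For small `u` this
follows by expanding the exponentials, because the `m`-th difference of `x ^ m` is `m!`; both sides
are analytic in `u`, hence it holds on all of `(0, 1)`. For `u = exp (-t)` it expands `exp (-(σ t))`
into multiples of `h'(t) exp (-((σ + n) h(t)))`, and after multiplication by `exp (-(a h(t)))` each
term has an elementary antiderivative (`hasSum_integral_exp_eq_abel`).

*The Kummer function.* The integrand is `exp (-((σ + a) t)) exp (a (1 - exp (-t)))`; expanding the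
second factor gives a series of Beta integrals (`integral_exp_eq_kummerPhi`).
-/

/-! ### The series of Abel type -/

theorem sum_neg_one_pow_mul_choose_mul_add_pow (x : ℝ) (m : ℕ) :
    ∑ k ∈ Finset.range (m + 1), (-1) ^ (m - k) * (m.choose k : ℝ) * (x + k) ^ m = m.factorial := by
  have h := congrFun (fwdDiff_iter_eq_factorial (R := ℝ) (n := m)) x
  rw [fwdDiff_iter_eq_sum_shift] at h
  simpa using h

/-- The series of `hasSum_abel` where it stays absolutely convergent after the expansion of all the
exponentials `exp (-((σ + n) u))`; the smallness condition on `u` is what this requires. -/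
theorem hasSum_abel_of_small {σ u : ℝ} (hσ : 0 ≤ σ) (hu : 0 ≤ u) (hu' : u * Real.exp (1 + u) < 1) :
    HasSum (fun n : ℕ => (σ + n) ^ n / n.factorial * (u * Real.exp (-u)) ^ n)
      (Real.exp (σ * u) / (1 - u)) := by
  have hu1 : u < 1 := by
    have : 1 ≤ Real.exp (1 + u) := Real.one_le_exp (by linarith)
    nlinarith
  -- Summing over the rows `n` gives the series in question, and over the diagonals `1 / (1 - u)`.
  set F : ℕ × ℕ → ℝ := fun p =>
    ((σ + p.1) * u) ^ p.1 / p.1.factorial * ((-((σ + p.1) * u)) ^ p.2 / p.2.factorial) with hF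
  have hexp (x : ℝ) : HasSum (fun k : ℕ => x ^ k / (k.factorial : ℝ)) (Real.exp x) := by
    rw [Real.exp_eq_exp_ℝ]; exact NormedSpace.expSeries_div_hasSum_exp x
  have hnn (n : ℕ) : 0 ≤ (σ + n) * u := by positivity
  have hsum : Summable F := by
    rw [← summable_norm_iff]
    have hnorm (n k : ℕ) : ‖F (n, k)‖ =
        ((σ + n) * u) ^ n / n.factorial * (((σ + n) * u) ^ k / k.factorial) := by
      simp only [hF, norm_mul, norm_div, norm_pow, norm_neg, Real.norm_of_nonneg (hnn n),
        Real.norm_natCast]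
    have hrow (n : ℕ) : HasSum (fun k => ‖F (n, k)‖)
        (((σ + n) * u) ^ n / n.factorial * Real.exp ((σ + n) * u)) := by
      simp only [hnorm]
      exact (hexp _).mul_left _
    rw [summable_prod_of_nonneg fun _ => norm_nonneg _]
    refine ⟨fun n => (hrow n).summable, ?_⟩
    simp only [fun n => (hrow n).tsum_eq]
    refine Summable.of_nonneg_of_le (fun n => by have := hnn n; positivity) (fun n => ?_)
      ((summable_geometric_of_lt_one (by positivity) hu').mul_left (Real.exp (σ * (1 + u))))
    have h1 : (σ + n) ^ n / n.factorial ≤ Real.exp (σ + n) :=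
      Real.pow_div_factorial_le_exp _ (by positivity) n
    calc ((σ + n) * u) ^ n / n.factorial * Real.exp ((σ + n) * u)
        = (σ + n) ^ n / n.factorial * (u ^ n * Real.exp ((σ + n) * u)) := by rw [mul_pow]; ring
      _ ≤ Real.exp (σ + n) * (u ^ n * Real.exp ((σ + n) * u)) := by gcongr
      _ = Real.exp (σ * (1 + u)) * (u * Real.exp (1 + u)) ^ n := by
        rw [mul_pow, ← Real.exp_nat_mul, mul_left_comm, ← Real.exp_add, mul_left_comm,
          ← Real.exp_add]
        ring_nf
  have hdiag (m : ℕ) : ∑ p ∈ Finset.HasAntidiagonal.antidiagonal m, F p = u ^ m := by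
    rw [Finset.Nat.sum_antidiagonal_eq_sum_range_succ_mk]
    have hm : (m.factorial : ℝ) ≠ 0 := by positivity
    have : ∀ k ∈ Finset.range (m + 1), F (k, m - k) =
        u ^ m / m.factorial * ((-1) ^ (m - k) * (m.choose k : ℝ) * (σ + k) ^ m) := by
      intro k hk
      have hk : k ≤ m := by simpa [Nat.lt_succ_iff] using hk
      have hc := Nat.choose_mul_factorial_mul_factorial hk
      rw [← hc]
      have : (m.choose k : ℝ) ≠ 0 := by exact_mod_cast (Nat.choose_pos hk).ne'
      obtain ⟨j, rfl⟩ := Nat.exists_eq_add_of_le hk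
      simp only [hF, Nat.add_sub_cancel_left]
      push_cast
      rw [neg_pow ((σ + k) * u) j, pow_add, pow_add, mul_pow, mul_pow]
      field_simp
    rw [Finset.sum_congr rfl this, ← Finset.mul_sum, sum_neg_one_pow_mul_choose_mul_add_pow]
    field_simp
  have htot : HasSum (fun m : ℕ => u ^ m) (∑' p, F p) := by
    have h1 := (Finset.HasAntidiagonal.sigmaAntidiagonalEquivProd (A := ℕ)).hasSum_iff.2 hsum.hasSum
    have h2 := h1.sigma fun m => hasSum_fintype _
    convert! h2 using 2 with m
    rw [← hdiag m, ← Finset.sum_coe_sort]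
    rfl
  have hval : ∑' p, F p = 1 / (1 - u) := by
    rw [one_div]
    exact htot.unique (hasSum_geometric_of_lt_one hu hu1)
  have hrows : HasSum (fun n : ℕ => ((σ + n) * u) ^ n / n.factorial * Real.exp (-((σ + n) * u)))
      (1 / (1 - u)) := by
    rw [← hval]
    exact hsum.hasSum.prod_fiberwise fun n => (hexp _).mul_left _
  have h := hrows.mul_left (Real.exp (σ * u))
  rw [mul_one_div] at h
  refine h.congr_fun fun n => ?_
  rw [mul_pow, mul_pow, ← Real.exp_nat_mul, mul_left_comm (Real.exp (σ * u)), ← Real.exp_add,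
    show σ * u + -((σ + n) * u) = n * -u by ring]
  ring

open Filter Topology in
/-- Both sides are analytic in `u ∈ (0, 1)`, since `u * exp (-u) < exp (-1)` there and the power
series with coefficients `(σ + n) ^ n / n!` converges in the disc of radius `exp (-1)`; they agree
near `1 / 10` by `hasSum_abel_of_small`. -/
theorem hasSum_abel {σ u : ℝ} (hσ : 0 ≤ σ) (hu : u ∈ Set.Ioo (0 : ℝ) 1) :
    HasSum (fun n : ℕ => (σ + n) ^ n / n.factorial * (u * Real.exp (-u)) ^ n)
      (Real.exp (σ * u) / (1 - u)) := by
  set c : ℕ → ℝ := fun n => (σ + n) ^ n / n.factorial with hc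
  set p := FormalMultilinearSeries.ofScalars ℝ c with hp
  have hrad : ENNReal.ofReal (Real.exp (-1)) ≤ p.radius := by
    refine p.le_radius_of_bound (Real.exp σ) fun n => ?_
    have h1 : (σ + n) ^ n / n.factorial ≤ Real.exp (σ + n) :=
      Real.pow_div_factorial_le_exp _ (by positivity) n
    rw [Real.coe_toNNReal _ (Real.exp_pos _).le]
    have h2 : ‖p n‖ ≤ c n := by
      have : 0 ≤ c n := by simp only [hc]; positivity
      simp [hp, abs_of_nonneg this]
    calc ‖p n‖ * Real.exp (-1) ^ n ≤ Real.exp (σ + n) * Real.exp (-1) ^ n := by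
          gcongr; exact h2.trans h1
      _ = Real.exp σ := by
          rw [← Real.exp_nat_mul, ← Real.exp_add]; ring_nf
  have hpos : 0 < p.radius := lt_of_lt_of_le (by simp [Real.exp_pos]) hrad
  have hps := p.hasFPowerSeriesOnBall hpos
  have hmem {v : ℝ} (hv : v ∈ Set.Ioo (0 : ℝ) 1) :
      v * Real.exp (-v) ∈ Metric.eball (0 : ℝ) p.radius := by
    refine Metric.eball_subset_eball hrad ?_
    have h0 : 0 < v * Real.exp (-v) := mul_pos hv.1 (Real.exp_pos _)
    rw [Metric.mem_eball, edist_dist, dist_zero_right, Real.norm_of_nonneg h0.le,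
      ENNReal.ofReal_lt_ofReal_iff (Real.exp_pos _)]
    have h1 := Real.add_one_lt_exp (x := v - 1) (by linarith [hv.2])
    calc v * Real.exp (-v) < Real.exp (v - 1) * Real.exp (-v) := by
          gcongr; linarith
      _ = Real.exp (-1) := by rw [← Real.exp_add]; ring_nf
  have hseries {v : ℝ} (hv : v ∈ Set.Ioo (0 : ℝ) 1) :
      HasSum (fun n : ℕ => c n * (v * Real.exp (-v)) ^ n) (p.sum (v * Real.exp (-v))) := by
    have := hps.hasSum (hmem hv)
    simpa [hp, FormalMultilinearSeries.ofScalars_apply_eq, zero_add, mul_comm] using this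
  have hf : AnalyticOnNhd ℝ (fun v : ℝ => p.sum (v * Real.exp (-v))) (Set.Ioo 0 1) := by
    intro v hv
    refine AnalyticAt.fun_comp (hps.analyticOnNhd _ (hmem hv)) ?_
    exact analyticAt_id.mul (analyticAt_id.neg.rexp')
  have hg : AnalyticOnNhd ℝ (fun v : ℝ => Real.exp (σ * v) / (1 - v)) (Set.Ioo 0 1) := by
    intro v hv
    refine AnalyticAt.div ?_ (analyticAt_const.sub analyticAt_id) (by simp; linarith [hv.2])
    exact (analyticAt_const.mul analyticAt_id).rexp'
  have hev : (fun v : ℝ => p.sum (v * Real.exp (-v))) =ᶠ[𝓝 (1 / 10)]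
      fun v : ℝ => Real.exp (σ * v) / (1 - v) := by
    filter_upwards [Ioo_mem_nhds (show (0 : ℝ) < 1 / 10 by norm_num)
      (show (1 / 10 : ℝ) < 1 / 5 by norm_num)] with v hv
    refine (hseries ⟨hv.1, by linarith [hv.2]⟩).unique (hasSum_abel_of_small hσ hv.1.le ?_)
    have h2 : Real.exp (1 + v) < 5 := by
      have h3 : Real.exp (1 + v) ^ 5 < 5 ^ 5 := by
        rw [← Real.exp_nat_mul]
        calc Real.exp ((5 : ℕ) * (1 + v)) ≤ Real.exp ((6 : ℕ) * 1) := by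
              rw [Real.exp_le_exp]; push_cast; linarith [hv.2]
          _ = Real.exp 1 ^ 6 := by rw [← Real.exp_nat_mul]
          _ < 2.72 ^ 6 := by
              gcongr; linarith [Real.exp_one_lt_d9]
          _ < 5 ^ 5 := by norm_num
      exact lt_of_pow_lt_pow_left₀ 5 (by norm_num) h3
    nlinarith [hv.1, hv.2]
  have := hf.eqOn_of_preconnected_of_eventuallyEq hg isPreconnected_Ioo
    (show (1 / 10 : ℝ) ∈ Set.Ioo (0 : ℝ) 1 by constructor <;> norm_num) hev hu
  have h := hseries hu
  rwa [show p.sum (u * Real.exp (-u)) = _ from this] at h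

/-! ### The Laplace transform of the departure process -/

/-- The integral over `[0, t]` of the probability `1 - exp (-s)` that a unit-rate service is over
after time `s`. For arrivals at rate `ρ`, the mean number of departures by time `t` is `ρ` times
this. -/
noncomputable def integratedServiceCdf (t : ℝ) : ℝ := t - 1 + Real.exp (-t)

theorem integratedServiceCdf_zero : integratedServiceCdf 0 = 0 := by
  simp [integratedServiceCdf]

theorem hasDerivAt_integratedServiceCdf (t : ℝ) :
    HasDerivAt integratedServiceCdf (1 - Real.exp (-t)) t := by
  have h := ((hasDerivAt_id t).sub_const 1).add (hasDerivAt_id t).neg.exp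
  convert! h using 1
  simp [sub_eq_add_neg]

@[fun_prop]
theorem continuous_integratedServiceCdf : Continuous integratedServiceCdf := by
  unfold integratedServiceCdf
  fun_prop

theorem integratedServiceCdf_nonneg (t : ℝ) : 0 ≤ integratedServiceCdf t := by
  have := Real.add_one_le_exp (-t)
  unfold integratedServiceCdf
  linarith

theorem one_sub_exp_neg_mem {t : ℝ} (ht : 0 ≤ t) : 1 - Real.exp (-t) ∈ Set.Icc (0 : ℝ) 1 := by
  have h1 : Real.exp (-t) ≤ 1 := Real.exp_le_one_iff.2 (by linarith)
  constructor <;> linarith [Real.exp_pos (-t)]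

theorem integrableOn_exp_neg_mul_sub_integratedServiceCdf {s : ℝ} {b : ℂ} (hsb : 0 < s + b.re) :
    IntegrableOn (fun t : ℝ => Complex.exp (-(s * t) - b * integratedServiceCdf t))
      (Set.Ioi 0) := by
  refine Integrable.mono' (g := fun t => Real.exp |b.re| * Real.exp (-(s + b.re) * t))
    ((exp_neg_integrableOn_Ioi 0 hsb).const_mul _)
    (Continuous.aestronglyMeasurable (by fun_prop)) ?_
  filter_upwards [ae_restrict_mem measurableSet_Ioi] with t ht
  rw [Complex.norm_exp, ← Real.exp_add, Real.exp_le_exp]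
  have hE := one_sub_exp_neg_mem (le_of_lt ht)
  have h2 : b.re * (1 - Real.exp (-t)) ≤ |b.re| := by
    calc b.re * (1 - Real.exp (-t)) ≤ |b.re| * (1 - Real.exp (-t)) :=
          mul_le_mul_of_nonneg_right (le_abs_self _) hE.1
      _ ≤ |b.re| * 1 := by gcongr; exact hE.2
      _ = |b.re| := mul_one _
  simp only [Complex.sub_re, Complex.neg_re, Complex.mul_re, Complex.ofReal_re, Complex.ofReal_im,
    integratedServiceCdf]
  linarith

theorem integrableOn_one_sub_exp_mul_exp {b : ℂ} (hb : 0 < b.re) :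
    IntegrableOn (fun t : ℝ => ((1 - Real.exp (-t) : ℝ) : ℂ) *
      Complex.exp (-(b * integratedServiceCdf t))) (Set.Ioi 0) := by
  have h := integrableOn_exp_neg_mul_sub_integratedServiceCdf (s := 0) (b := b) (by simpa using hb)
  refine h.norm.mono' (Continuous.aestronglyMeasurable (by fun_prop)) ?_
  filter_upwards [ae_restrict_mem measurableSet_Ioi] with t ht
  have hE := one_sub_exp_neg_mem (le_of_lt ht)
  rw [norm_mul, Complex.norm_real, Real.norm_of_nonneg hE.1]
  simpa using mul_le_of_le_one_left
    (norm_nonneg (Complex.exp (-(b * integratedServiceCdf t)))) hE.2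

open Filter Topology in
theorem integral_one_sub_exp_mul_exp {b : ℂ} (hb : 0 < b.re) :
    ∫ t : ℝ in Set.Ioi 0, ((1 - Real.exp (-t) : ℝ) : ℂ) *
      Complex.exp (-(b * integratedServiceCdf t)) = 1 / b := by
  have hb0 : b ≠ 0 := by rintro rfl; simp at hb
  have hd (t : ℝ) : HasDerivAt
      (fun t : ℝ => -(1 / b) * Complex.exp (-(b * integratedServiceCdf t)))
      (((1 - Real.exp (-t) : ℝ) : ℂ) * Complex.exp (-(b * integratedServiceCdf t))) t := by
    have h1 := (((hasDerivAt_integratedServiceCdf t).ofReal_comp.const_mul b).neg.cexp).const_mul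
      (-(1 / b))
    convert! h1 using 1
    simp only [Pi.neg_apply]
    field_simp
  have hlim : Tendsto (fun t : ℝ => -(1 / b) * Complex.exp (-(b * integratedServiceCdf t)))
      atTop (𝓝 0) := by
    have h1 : Tendsto integratedServiceCdf atTop atTop :=
      tendsto_atTop_mono (f := fun t => t - 1)
        (fun t => by unfold integratedServiceCdf; linarith [Real.exp_pos (-t)])
        (tendsto_atTop_add_const_right _ _ tendsto_id)
    have h2 : Tendsto (fun t : ℝ => Complex.exp (-(b * integratedServiceCdf t))) atTop (𝓝 0) := by
      rw [Complex.tendsto_exp_nhds_zero_iff]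
      simp only [Complex.neg_re, Complex.mul_re, Complex.ofReal_re, Complex.ofReal_im, mul_zero,
        sub_zero]
      exact tendsto_neg_atTop_atBot.comp (h1.const_mul_atTop hb)
    simpa using h2.const_mul (-(1 / b))
  rw [integral_Ioi_of_hasDerivAt_of_tendsto' (fun t _ => hd t)
    (integrableOn_one_sub_exp_mul_exp hb) hlim]
  simp [integratedServiceCdf_zero]

/-- The identity `hasSum_abel` at `u = exp (-t)`, where `u * exp (-u)` is
`exp (-1) * exp (-integratedServiceCdf t)` and `1 - u` is the derivative of `integratedServiceCdf`
at `t`. -/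
theorem hasSum_abel_exp {σ t : ℝ} (hσ : 0 ≤ σ) (ht : 0 < t) :
    HasSum (fun n : ℕ => (σ + n) ^ n * Real.exp (-(σ + n)) / n.factorial *
      ((1 - Real.exp (-t)) * Real.exp (-((σ + n) * integratedServiceCdf t))))
      (Real.exp (-(σ * t))) := by
  have hu : Real.exp (-t) ∈ Set.Ioo (0 : ℝ) 1 :=
    ⟨Real.exp_pos _, by simpa using ht⟩
  have h := (hasSum_abel hσ hu).mul_left
    ((1 - Real.exp (-t)) * Real.exp (-(σ * (t + Real.exp (-t)))))
  have hne : 1 - Real.exp (-t) ≠ 0 := by linarith [hu.2]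
  convert! h using 1
  · ext n
    have : Real.exp (-(σ + n)) * Real.exp (-((σ + n) * integratedServiceCdf t)) =
        Real.exp (-(σ * (t + Real.exp (-t)))) * (Real.exp (-t) * Real.exp (-Real.exp (-t))) ^ n := by
      rw [← Real.exp_add, ← Real.exp_add, ← Real.exp_nat_mul, ← Real.exp_add, integratedServiceCdf]
      ring_nf
    linear_combination (σ + n) ^ n / n.factorial * (1 - Real.exp (-t)) * this
  · rw [mul_div_assoc', mul_assoc, ← Real.exp_add, mul_div_cancel_left₀ _ hne]
    ring_nf

theorem hasSum_integral_exp_eq_abel {σ : ℝ} {a : ℂ} (hσ : 0 < σ) (ha : 0 < σ + a.re) :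
    HasSum (fun n : ℕ => (σ + n : ℂ) ^ n * Complex.exp (-(σ + n : ℂ)) / (n.factorial : ℂ) *
      (1 / (σ + n + a)))
      (∫ t : ℝ in Set.Ioi 0, Complex.exp (-(σ * t) - a * integratedServiceCdf t)) := by
  set c : ℕ → ℝ := fun n => (σ + n) ^ n * Real.exp (-(σ + n)) / n.factorial with hc
  have hc0 (n : ℕ) : 0 ≤ c n := by positivity
  set F : ℕ → ℝ → ℂ := fun n t => c n * (((1 - Real.exp (-t) : ℝ) : ℂ) *
    Complex.exp (-((σ + n + a) * integratedServiceCdf t))) with hF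
  have hre (n : ℕ) : 0 < (σ + n + a : ℂ).re := by
    have : (0 : ℝ) ≤ n := n.cast_nonneg
    simp only [Complex.add_re, Complex.ofReal_re, Complex.natCast_re]
    linarith
  have hsumF {t : ℝ} (ht : 0 < t) (a : ℂ) : HasSum
      (fun n => (c n : ℂ) * (((1 - Real.exp (-t) : ℝ) : ℂ) *
        Complex.exp (-((σ + n + a) * integratedServiceCdf t))))
      (Complex.exp (-(σ * t) - a * integratedServiceCdf t)) := by
    have h := (Complex.hasSum_ofReal.2 (hasSum_abel_exp hσ.le ht)).mul_right
      (Complex.exp (-(a * integratedServiceCdf t)))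
    convert! h using 1
    · ext n
      simp only [hc]
      push_cast
      rw [mul_assoc, mul_assoc (1 - Complex.exp (-(t : ℂ))), ← Complex.exp_add]
      ring_nf
    · push_cast
      rw [← Complex.exp_add]
      ring_nf
  -- Passing to norms replaces `a` by `a.re`, so the expansion provides its own dominating series.
  have hnorm {t : ℝ} (ht : 0 < t) : HasSum (fun n => ‖F n t‖)
      ‖Complex.exp (-(σ * t) - a * integratedServiceCdf t)‖ := by
    have h := hsumF ht a.re
    rw [← Complex.hasSum_ofReal]
    convert! h using 1
    · ext n
      simp only [hF, norm_mul, Complex.norm_real, Complex.norm_exp, Real.norm_of_nonneg (hc0 n),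
        Real.norm_of_nonneg (one_sub_exp_neg_mem ht.le).1]
      push_cast
      congr 3
      simp
    · rw [Complex.norm_exp]
      push_cast
      congr 1
      simp
  have h := hasSum_integral_of_dominated_convergence (μ := volume.restrict (Set.Ioi (0 : ℝ)))
    (F := F) (f := fun t : ℝ => Complex.exp (-(σ * t) - a * integratedServiceCdf t))
    (fun n t => ‖F n t‖) (fun n => ((integrableOn_one_sub_exp_mul_exp (hre n)).const_mul _).1)
    (fun n => ae_of_all _ fun t => le_rfl) ?_ ?_ ?_
  · convert! h using 1
    ext n
    simp only [hF]
    rw [integral_const_mul, integral_one_sub_exp_mul_exp (hre n)]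
    simp only [hc]
    push_cast
    rfl
  · filter_upwards [ae_restrict_mem measurableSet_Ioi] with t ht using (hnorm ht).summable
  · refine (integrableOn_exp_neg_mul_sub_integratedServiceCdf ha).norm.congr ?_
    filter_upwards [ae_restrict_mem measurableSet_Ioi] with t ht using (hnorm ht).tsum_eq.symm
  · filter_upwards [ae_restrict_mem measurableSet_Ioi] with t ht using hsumF ht a

/-! ### The Kummer function -/

theorem integrableOn_exp_neg_mul_mul_pow {b : ℂ} (hb : 0 < b.re) (n : ℕ) :
    IntegrableOn (fun t : ℝ => Complex.exp (-b * t) * ((1 - Real.exp (-t) : ℝ) : ℂ) ^ n)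
      (Set.Ioi 0) := by
  refine (integrableOn_exp_mul_complex_Ioi (a := -b) (by simpa using hb) 0).norm.mono'
    (Continuous.aestronglyMeasurable (by fun_prop)) ?_
  filter_upwards [ae_restrict_mem measurableSet_Ioi] with t ht
  have hE := one_sub_exp_neg_mem (le_of_lt ht)
  rw [norm_mul, norm_pow, Complex.norm_real, Real.norm_of_nonneg hE.1]
  exact mul_le_of_le_one_right (norm_nonneg _) (pow_le_one₀ hE.1 hE.2)

theorem ascPochhammer_eval_ne_zero {b : ℂ} (hb : 0 < b.re) (n : ℕ) :
    (ascPochhammer ℂ n).eval b ≠ 0 := by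
  induction n with
  | zero => simp
  | succ n ih =>
    rw [ascPochhammer_succ_eval]
    refine mul_ne_zero ih fun h => ?_
    have := congrArg Complex.re h
    simp only [Complex.add_re, Complex.natCast_re, Complex.zero_re] at this
    have : (0 : ℝ) ≤ n := n.cast_nonneg
    linarith

theorem ascPochhammer_succ_eval_left (b : ℂ) (n : ℕ) :
    (ascPochhammer ℂ (n + 1)).eval b = b * (ascPochhammer ℂ n).eval (b + 1) := by
  simp [ascPochhammer_succ_left, Polynomial.eval_comp]

/-- The Beta integral `B(b, n + 1)` after the substitution `u = exp (-t)`. -/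
theorem integral_exp_neg_mul_mul_pow {b : ℂ} (hb : 0 < b.re) (n : ℕ) :
    ∫ t : ℝ in Set.Ioi 0, Complex.exp (-b * t) * ((1 - Real.exp (-t) : ℝ) : ℂ) ^ n =
      n.factorial / (ascPochhammer ℂ (n + 1)).eval b := by
  induction n generalizing b with
  | zero =>
    simp only [pow_zero, mul_one]
    rw [integral_exp_mul_complex_Ioi (by simpa using hb)]
    simp
  | succ n ih =>
    have hb1 : 0 < (b + 1).re := by simp only [Complex.add_re, Complex.one_re]; linarith
    -- Splitting off one factor `1 - exp (-t)` gives `B(b, n + 2) = B(b, n + 1) - B(b + 1, n + 1)`.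
    have hsplit : ∀ t : ℝ, Complex.exp (-b * t) * ((1 - Real.exp (-t) : ℝ) : ℂ) ^ (n + 1) =
        Complex.exp (-b * t) * ((1 - Real.exp (-t) : ℝ) : ℂ) ^ n -
          Complex.exp (-(b + 1) * t) * ((1 - Real.exp (-t) : ℝ) : ℂ) ^ n := by
      intro t
      have : Complex.exp (-(b + 1) * t) = Complex.exp (-b * t) * Complex.exp (-t) := by
        rw [← Complex.exp_add]; ring_nf
      rw [this]
      push_cast
      ring
    simp only [hsplit]
    rw [integral_sub (integrableOn_exp_neg_mul_mul_pow hb n)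
      (integrableOn_exp_neg_mul_mul_pow hb1 n), ih hb, ih hb1]
    have h0 : b ≠ 0 := by rintro rfl; simp at hb
    have h1 := ascPochhammer_eval_ne_zero hb1 n
    have h2 := ascPochhammer_eval_ne_zero hb1 (n + 1)
    rw [ascPochhammer_succ_eval_left b, ascPochhammer_succ_eval_left b]
    rw [ascPochhammer_succ_eval] at h2 ⊢
    have h3 := right_ne_zero_of_mul h2
    rw [Nat.factorial_succ]
    push_cast
    field_simp
    ring

theorem integral_exp_eq_kummerPhi {σ : ℝ} {a : ℂ} (ha : 0 < σ + a.re) :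
    ∫ t : ℝ in Set.Ioi 0, Complex.exp (-(σ * t) - a * integratedServiceCdf t) =
      1 / (σ + a) * kummerPhi 1 (σ + a + 1) a := by
  have hre : 0 < (σ + a : ℂ).re := by simpa using ha
  have hb0 : (σ + a : ℂ) ≠ 0 := by intro h; rw [h] at hre; simp at hre
  set F : ℕ → ℝ → ℂ := fun n t => a ^ n / n.factorial *
    (Complex.exp (-(σ + a) * t) * ((1 - Real.exp (-t) : ℝ) : ℂ) ^ n) with hF
  have hnorm {t : ℝ} (ht : 0 < t) : HasSum (fun n => ‖F n t‖)
      (‖Complex.exp (-(σ + a) * t)‖ * Real.exp (‖a‖ * (1 - Real.exp (-t)))) := by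
    have h := (NormedSpace.expSeries_div_hasSum_exp (‖a‖ * (1 - Real.exp (-t)))).mul_left
      ‖Complex.exp (-(σ + a) * t)‖
    rw [← Real.exp_eq_exp_ℝ] at h
    convert! h using 2 with n
    simp only [hF, norm_mul, norm_div, norm_pow, Complex.norm_real, Complex.norm_natCast,
      Real.norm_of_nonneg (one_sub_exp_neg_mem ht.le).1]
    rw [mul_pow]
    ring
  have h := hasSum_integral_of_dominated_convergence (μ := volume.restrict (Set.Ioi (0 : ℝ)))
    (F := F) (f := fun t : ℝ => Complex.exp (-(σ * t) - a * integratedServiceCdf t))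
    (fun n t => ‖F n t‖) (fun n => ((integrableOn_exp_neg_mul_mul_pow hre n).const_mul _).1)
    (fun n => ae_of_all _ fun t => le_rfl) ?_ ?_ ?_
  · rw [kummerPhi, ← tsum_mul_left, ← h.tsum_eq]
    congr 1
    ext n
    simp only [hF]
    have hn : (n.factorial : ℂ) ≠ 0 := by exact_mod_cast n.factorial_ne_zero
    rw [integral_const_mul, integral_exp_neg_mul_mul_pow hre, ascPochhammer_succ_eval_left,
      ascPochhammer_eval_one]
    have h1 := ascPochhammer_eval_ne_zero (b := σ + a + 1)
      (by rw [Complex.add_re, Complex.one_re]; linarith) n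
    field_simp
  · filter_upwards [ae_restrict_mem measurableSet_Ioi] with t ht using (hnorm ht).summable
  · have h1 : IntegrableOn (fun t : ℝ => ‖Complex.exp (-(σ + a) * t)‖ *
        Real.exp (‖a‖ * (1 - Real.exp (-t)))) (Set.Ioi 0) := by
      refine ((integrableOn_exp_mul_complex_Ioi (a := -(σ + a)) (by rw [Complex.neg_re]; linarith)
        0).norm.mul_const (Real.exp ‖a‖)).mono' (Continuous.aestronglyMeasurable (by fun_prop)) ?_
      filter_upwards [ae_restrict_mem measurableSet_Ioi] with t ht
      have hE := one_sub_exp_neg_mem (le_of_lt ht)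
      rw [norm_mul, norm_norm, Real.norm_of_nonneg (Real.exp_pos _).le]
      gcongr
      exact mul_le_of_le_one_right (norm_nonneg _) hE.2
    refine h1.congr ?_
    filter_upwards [ae_restrict_mem measurableSet_Ioi] with t ht using (hnorm ht).tsum_eq.symm
  · filter_upwards [ae_restrict_mem measurableSet_Ioi] with t ht
    have h1 := (NormedSpace.expSeries_div_hasSum_exp (a * (1 - Real.exp (-t) : ℝ))).mul_left
      (Complex.exp (-(σ + a) * t))
    rw [← Complex.exp_eq_exp_ℂ, ← Complex.exp_add] at h1
    convert! h1 using 1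
    · ext n
      simp only [hF]
      ring
    · simp only [integratedServiceCdf]
      push_cast
      ring_nf

/-! ### Exponential laws and independence -/

theorem ae_nonneg_expMeasure (r : ℝ) : ∀ᵐ x ∂expMeasure r, 0 ≤ x := by
  rw [ae_iff]
  simp only [not_le]
  change (volume.withDensity (exponentialPDF r)) (Set.Iio 0) = 0
  rw [withDensity_apply _ measurableSet_Iio, lintegral_exponentialPDF_of_nonpos le_rfl]

theorem integral_expMeasure {r : ℝ} (hr : 0 < r) (f : ℝ → ℂ) :
    ∫ x, f x ∂expMeasure r = ∫ x in Set.Ioi 0, (r * Real.exp (-(r * x)) : ℝ) * f x := by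
  change ∫ x, f x ∂(volume.withDensity (exponentialPDF r)) = _
  have hm : Measurable (exponentialPDF r) := (measurable_exponentialPDFReal r).ennreal_ofReal
  rw [integral_withDensity_eq_integral_toReal_smul hm (ae_of_all _ fun x => ENNReal.ofReal_lt_top),
    ← integral_Ici_eq_integral_Ioi, ← integral_indicator measurableSet_Ici]
  congr 1
  ext x
  by_cases hx : 0 ≤ x
  · rw [Set.indicator_of_mem (Set.mem_Ici.2 hx), exponentialPDF_of_nonneg hx,
      ENNReal.toReal_ofReal (by positivity), Complex.real_smul]
  · rw [Set.indicator_of_notMem (by simpa using hx), exponentialPDF_of_neg (not_le.1 hx)]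
    simp

theorem integral_expMeasure_ite {r : ℝ} (hr : 0 < r) {t : ℝ} (ht : 0 ≤ t) (z : ℂ) :
    ∫ x, (if x ≤ t then z else 1) ∂expMeasure r = 1 + (z - 1) * (1 - Real.exp (-(r * t)) : ℝ) := by
  have := isProbabilityMeasure_expMeasure hr
  have h : ∀ x : ℝ, (if x ≤ t then z else 1) =
      1 + (Set.Iic t).indicator (fun _ => z - 1) x := by
    intro x
    by_cases hx : x ≤ t <;> simp [hx]
  simp only [h]
  rw [integral_add (integrable_const _) ((integrable_const _).indicator measurableSet_Iic),
    integral_indicator_const _ measurableSet_Iic, ← cdf_eq_real, cdf_expMeasure_eq hr, if_pos ht]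
  simp [mul_comm]

/-- Fubini for an independent pair: the second variable may be integrated out against its law. -/
theorem ProbabilityTheory.IndepFun.integral_comp_prodMk [MeasurableSpace Ω] {P : Measure Ω}
    [IsProbabilityMeasure P] {E F : Type*} [MeasurableSpace E] [MeasurableSpace F] {Y : Ω → E}
    {V : Ω → F} (h : IndepFun Y V P) (hY : Measurable Y) (hV : Measurable V) {f : E → F → ℂ}
    (hf : Measurable (Function.uncurry f)) (hint : Integrable (fun ω => f (Y ω) (V ω)) P) :
    ∫ ω, f (Y ω) (V ω) ∂P = ∫ ω, ∫ v, f (Y ω) v ∂P.map V ∂P := by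
  have := Measure.isProbabilityMeasure_map (μ := P) hY.aemeasurable
  have := Measure.isProbabilityMeasure_map (μ := P) hV.aemeasurable
  have hmap := h.map_prod_eq_prod_map_map hY.aemeasurable hV.aemeasurable
  have hYV := hY.prodMk hV
  have hi : Integrable (Function.uncurry f) ((P.map Y).prod (P.map V)) := by
    rw [← hmap, integrable_map_measure hf.aestronglyMeasurable hYV.aemeasurable]
    exact hint
  calc ∫ ω, f (Y ω) (V ω) ∂P = ∫ p, Function.uncurry f p ∂(P.map fun ω => (Y ω, V ω)) := by
        rw [integral_map hYV.aemeasurable hf.aestronglyMeasurable]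
        rfl
    _ = ∫ y, ∫ v, f y v ∂P.map V ∂P.map Y := by
        rw [hmap, integral_prod _ hi]
        rfl
    _ = _ := by
        rw [integral_map hY.aemeasurable]
        exact hi.aestronglyMeasurable.integral_prod_right'

/-- A function of the variables other than `X j` is independent of `X j`. -/
theorem ProbabilityTheory.iIndepFun.indepFun_of_measurable_iSup_compl [MeasurableSpace Ω]
    {P : Measure Ω} {ι E : Type*} [MeasurableSpace E] {X : ι → Ω → ℝ} (hX : ∀ j, Measurable (X j))
    (h : iIndepFun X P) (j : ι) {Y : Ω → E}
    (hY : Measurable[⨆ i ∈ ({j}ᶜ : Set ι), MeasurableSpace.comap (X i) inferInstance] Y) :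
    IndepFun Y (X j) P := by
  have h1 := indep_iSup_of_disjoint (fun i => (hX i).comap_le) h.iIndep
    (S := {j}ᶜ) (T := {j}) (by simp)
  rw [IndepFun_iff_Indep]
  refine indep_of_indep_of_le_left (indep_of_indep_of_le_right h1 ?_) hY.comap_le
  simp

/-- A series of integrable functions whose `L¹` norms are summable may be integrated term by
term, and its sum is integrable. -/
theorem integrable_and_hasSum_integral [MeasurableSpace Ω] {P : Measure Ω} {F : ℕ → Ω → ℂ}
    {f : Ω → ℂ} (hF : ∀ n, Integrable (F n) P) (hsum : Summable fun n => ∫ ω, ‖F n ω‖ ∂P)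
    (hf : ∀ᵐ ω ∂P, HasSum (fun n => F n ω) (f ω)) :
    Integrable f P ∧ HasSum (fun n => ∫ ω, F n ω ∂P) (∫ ω, f ω ∂P) := by
  have hts : (fun ω => ∑' n, F n ω) =ᵐ[P] f := by
    filter_upwards [hf] with ω hω using hω.tsum_eq
  refine ⟨⟨?_, ?_⟩, ?_⟩
  · refine aestronglyMeasurable_of_tendsto_ae Filter.atTop
      (f := fun N ω => ∑ n ∈ Finset.range N, F n ω) (fun N => ?_) ?_
    · exact (integrable_finsetSum _ fun n _ => hF n).1
    · filter_upwards [hf] with ω hω using hω.tendsto_sum_nat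
  · calc ∫⁻ ω, ‖f ω‖ₑ ∂P ≤ ∫⁻ ω, ∑' n, ‖F n ω‖ₑ ∂P := by
          refine lintegral_mono_ae ?_
          filter_upwards [hts] with ω hω
          rw [← hω]
          exact enorm_tsum_le_tsum_enorm
      _ = ∑' n, ENNReal.ofReal (∫ ω, ‖F n ω‖ ∂P) := by
          rw [lintegral_tsum fun n => (hF n).1.enorm]
          simp only [ofReal_integral_norm_eq_lintegral_enorm (hF _)]
      _ = ENNReal.ofReal (∑' n, ∫ ω, ‖F n ω‖ ∂P) :=
          (ENNReal.ofReal_tsum_of_nonneg (fun n => integral_nonneg fun ω => norm_nonneg _)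
            hsum).symm
      _ < ⊤ := ENNReal.ofReal_lt_top
  · rw [← integral_congr_ae hts]
    exact hasSum_integral_of_summable_integral_norm hF hsum

/-! ### The weight of a Poisson number of customers -/

/-- The integral over `[0, t]` of the generating function `1 + (z - 1) (1 - exp (-s))` of the
indicator that a unit-rate service is over after time `s`. -/
noncomputable def integratedWeight (z : ℂ) (t : ℝ) : ℂ := t + (z - 1) * integratedServiceCdf t

theorem integratedWeight_zero (z : ℂ) : integratedWeight z 0 = 0 := by
  simp [integratedWeight, integratedServiceCdf_zero]

@[fun_prop]
theorem continuous_integratedWeight (z : ℂ) : Continuous (integratedWeight z) := by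
  unfold integratedWeight
  fun_prop

theorem hasDerivAt_integratedWeight (z : ℂ) (t : ℝ) :
    HasDerivAt (integratedWeight z) (1 + (z - 1) * (1 - Real.exp (-t) : ℝ)) t :=
  Complex.ofRealCLM.hasDerivAt.add
    ((hasDerivAt_integratedServiceCdf t).ofReal_comp.const_mul (z - 1))

theorem norm_integratedWeight_le_integratedWeight_norm (z : ℂ) {t : ℝ} (ht : 0 ≤ t) :
    ‖integratedWeight z t‖ ≤ t + (‖z‖ - 1) * integratedServiceCdf t := by
  have h1 : integratedWeight z t =
      ((t - integratedServiceCdf t : ℝ) : ℂ) + z * integratedServiceCdf t := by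
    simp only [integratedWeight]; push_cast; ring
  have h2 : 0 ≤ t - integratedServiceCdf t := by
    have := (one_sub_exp_neg_mem ht).1
    unfold integratedServiceCdf
    linarith
  rw [h1]
  refine (norm_add_le _ _).trans (le_of_eq ?_)
  rw [norm_mul, Complex.norm_real, Complex.norm_real, Real.norm_of_nonneg h2,
    Real.norm_of_nonneg (integratedServiceCdf_nonneg t)]
  ring

/-- The expectation of `z ^ D(r)` for an initially empty queue with arrival rate `ρ`, restricted to
the event that exactly `n` customers arrive by time `r`; it is extended by `0` to `r < 0`. -/
noncomputable def poissonWeight (ρ : ℝ) (z : ℂ) (n : ℕ) (r : ℝ) : ℂ :=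
  if 0 ≤ r then Complex.exp (-(ρ * r)) * (ρ * integratedWeight z r) ^ n / n.factorial else 0

@[fun_prop]
theorem measurable_poissonWeight (ρ : ℝ) (z : ℂ) (n : ℕ) : Measurable (poissonWeight ρ z n) := by
  unfold poissonWeight
  refine Measurable.ite measurableSet_Ici (Continuous.measurable ?_) measurable_const
  fun_prop

theorem norm_poissonWeight_le {ρ : ℝ} (hρ : 0 < ρ) (z : ℂ) (n : ℕ) (r : ℝ) :
    ‖poissonWeight ρ z n r‖ ≤ (1 + ‖z‖) ^ n := by
  unfold poissonWeight
  split_ifs with hr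
  · have h1 : ‖integratedWeight z r‖ ≤ (1 + ‖z‖) * r := by
      refine (norm_integratedWeight_le_integratedWeight_norm z hr).trans ?_
      have h0 := integratedServiceCdf_nonneg r
      have h2 : integratedServiceCdf r ≤ r := by
        have := (one_sub_exp_neg_mem hr).1
        unfold integratedServiceCdf
        linarith
      nlinarith [mul_le_mul_of_nonneg_left h2 (norm_nonneg z)]
    rw [norm_div, norm_mul, norm_pow, norm_mul, Complex.norm_natCast, Complex.norm_exp,
      Complex.norm_real, Real.norm_of_nonneg hρ.le]
    have h3 := Real.pow_div_factorial_le_exp (ρ * r) (by positivity) n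
    calc Real.exp (-(ρ * r : ℂ)).re * (ρ * ‖integratedWeight z r‖) ^ n / n.factorial
        ≤ Real.exp (-(ρ * r : ℂ)).re * (ρ * ((1 + ‖z‖) * r)) ^ n / n.factorial := by gcongr
      _ = (1 + ‖z‖) ^ n * (Real.exp (-(ρ * r)) * ((ρ * r) ^ n / n.factorial)) := by
          rw [show ρ * ((1 + ‖z‖) * r) = (1 + ‖z‖) * (ρ * r) by ring, mul_pow]
          simp only [Complex.neg_re, Complex.mul_re, Complex.ofReal_re, Complex.ofReal_im]
          ring_nf
      _ ≤ (1 + ‖z‖) ^ n * (Real.exp (-(ρ * r)) * Real.exp (ρ * r)) := by gcongr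
      _ = (1 + ‖z‖) ^ n := by rw [← Real.exp_add]; simp
  · simp only [norm_zero]; positivity

/-- The renewal equation obtained by conditioning on the arrival of the first of `n + 1`
customers. -/
theorem integral_expMeasure_mul_poissonWeight {ρ : ℝ} (hρ : 0 < ρ) (z : ℂ) (n : ℕ) (r : ℝ) :
    ∫ x, (1 + (z - 1) * (1 - Real.exp (-(r - x)) : ℝ)) * poissonWeight ρ z n (r - x) ∂expMeasure ρ =
      poissonWeight ρ z (n + 1) r := by
  rw [integral_expMeasure hρ]
  by_cases hr : 0 ≤ r
  · rw [setIntegral_eq_of_subset_of_forall_sdiff_eq_zero measurableSet_Ioi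
      (s := Set.Ioc 0 r) Set.Ioc_subset_Ioi_self, ← intervalIntegral.integral_of_le hr]
    · -- `exp (-(ρ x)) * exp (-(ρ (r - x)))` is constant in `x`, and the factor in front of the
      -- weight is the derivative of `integratedWeight z` at `r - x`.
      have hd : ∀ x ∈ Set.uIcc 0 r, HasDerivAt (fun x => -(Complex.exp (-(ρ * r)) *
          (ρ * integratedWeight z (r - x)) ^ (n + 1) / (n + 1).factorial))
          (Complex.exp (-(ρ * r)) * ρ * (1 + (z - 1) * (1 - Real.exp (-(r - x)) : ℝ)) *
            ((ρ * integratedWeight z (r - x)) ^ n / n.factorial)) x := by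
        intro x _
        have h1 := (hasDerivAt_integratedWeight z (r - x)).scomp x
          ((hasDerivAt_id x).const_sub r)
        have h2 := ((((h1.const_mul (ρ : ℂ)).pow (n + 1)).const_mul
          (Complex.exp (-(ρ * r)))).div_const ((n + 1).factorial : ℂ)).neg
        convert! h2 using 1
        have hn : (n.factorial : ℂ) ≠ 0 := by exact_mod_cast n.factorial_ne_zero
        have hn1 : (n + 1 : ℂ) ≠ 0 := by exact_mod_cast n.succ_ne_zero
        rw [Nat.factorial_succ]
        simp only [Function.comp, Nat.add_sub_cancel, neg_smul, one_smul]
        push_cast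
        field_simp
      rw [intervalIntegral.integral_congr (g := fun x =>
        Complex.exp (-(ρ * r)) * ρ * (1 + (z - 1) * (1 - Real.exp (-(r - x)) : ℝ)) *
            ((ρ * integratedWeight z (r - x)) ^ n / n.factorial)),
        intervalIntegral.integral_eq_sub_of_hasDerivAt hd]
      · simp [poissonWeight, hr, integratedWeight_zero]
      · exact Continuous.intervalIntegrable (by fun_prop) _ _
      · intro x hx
        rw [Set.uIcc_of_le hr] at hx
        simp only [poissonWeight, sub_nonneg, hx.2, if_true]
        have : Complex.exp (-(ρ * r)) = Complex.exp (-(ρ * x)) * Complex.exp (-(ρ * (r - x))) := by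
          rw [← Complex.exp_add]; ring_nf
        rw [this]
        push_cast
        ring
    · intro x hx
      have : ¬ 0 ≤ r - x := by
        intro h
        exact hx.2 ⟨hx.1, by linarith⟩
      simp [poissonWeight, this]
  · rw [setIntegral_eq_zero_of_forall_eq_zero]
    · simp [poissonWeight, hr]
    · intro x hx
      have : ¬ 0 ≤ r - x := by
        have : 0 < x := hx
        linarith
      simp [poissonWeight, this]

/-- For fixed `t` this is the exponential series; the same series at `‖z‖` dominates it. -/
theorem hasSum_integral_poissonWeight {ρ σ : ℝ} (hρ : 0 < ρ) (hσ : 0 < σ) {z : ℂ}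
    (hz : ρ * ‖z‖ < σ + ρ) :
    HasSum (fun n => ∫ t, poissonWeight ρ z n t ∂expMeasure σ)
      (σ * ∫ t : ℝ in Set.Ioi 0,
        Complex.exp (-(σ * t) - ρ * (1 - z) * integratedServiceCdf t)) := by
  rw [← integral_const_mul]
  simp only [integral_expMeasure hσ]
  have hexp (t : ℝ) (w : ℂ) (ht : 0 ≤ t) : HasSum
      (fun n => ((σ * Real.exp (-(σ * t)) : ℝ) : ℂ) * poissonWeight ρ w n t)
      (σ * Complex.exp (-(σ * t) - ρ * (1 - w) * integratedServiceCdf t)) := by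
    have h := (NormedSpace.expSeries_div_hasSum_exp (ρ * integratedWeight w t)).mul_left
      (σ * Complex.exp (-(σ * t)) * Complex.exp (-(ρ * t)))
    rw [← Complex.exp_eq_exp_ℂ, mul_assoc, mul_assoc, ← Complex.exp_add, ← Complex.exp_add] at h
    convert! h using 1
    · ext n
      simp only [poissonWeight, if_pos ht]
      rw [Complex.exp_add]
      push_cast
      ring
    · simp only [integratedWeight]
      ring_nf
  have hreal (t : ℝ) (n : ℕ) (ht : 0 ≤ t) : ∃ b : ℝ,
      ((σ * Real.exp (-(σ * t)) : ℝ) : ℂ) * poissonWeight ρ ‖z‖ n t = b ∧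
      ‖((σ * Real.exp (-(σ * t)) : ℝ) : ℂ) * poissonWeight ρ z n t‖ ≤ b := by
    refine ⟨σ * Real.exp (-(σ * t)) * (Real.exp (-(ρ * t)) *
      (ρ * (t + (‖z‖ - 1) * integratedServiceCdf t)) ^ n / n.factorial), ?_, ?_⟩
    · simp only [poissonWeight, if_pos ht, integratedWeight]
      push_cast
      rfl
    · rw [norm_mul, Complex.norm_real, Real.norm_of_nonneg (by positivity)]
      simp only [poissonWeight, if_pos ht]
      rw [norm_div, norm_mul, norm_pow, norm_mul, Complex.norm_natCast, Complex.norm_exp,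
        Complex.norm_real, Real.norm_of_nonneg hρ.le]
      have hre : (-(ρ * t : ℂ)).re = -(ρ * t) := by simp
      rw [hre]
      gcongr
      exact norm_integratedWeight_le_integratedWeight_norm z ht
  have hbound (t : ℝ) (ht : 0 ≤ t) : HasSum
      (fun n => (((σ * Real.exp (-(σ * t)) : ℝ) : ℂ) * poissonWeight ρ ‖z‖ n t).re)
      ‖σ * Complex.exp (-(σ * t) - ρ * (1 - ‖z‖) * integratedServiceCdf t)‖ := by
    convert! Complex.hasSum_re (hexp t ‖z‖ ht) using 1
    rw [norm_mul, Complex.norm_real, Real.norm_of_nonneg hσ.le, Complex.norm_exp,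
      Complex.re_ofReal_mul]
    congr 1
    have : (-(σ * t) - ρ * (1 - ‖z‖) * integratedServiceCdf t : ℂ) =
      ((-(σ * t) - ρ * (1 - ‖z‖) * integratedServiceCdf t : ℝ) : ℂ) := by push_cast; rfl
    rw [this, Complex.ofReal_re, ← Complex.ofReal_exp, Complex.ofReal_re]
  refine hasSum_integral_of_dominated_convergence
    (fun n t => (((σ * Real.exp (-(σ * t)) : ℝ) : ℂ) * poissonWeight ρ ‖z‖ n t).re)
    (fun n => Measurable.aestronglyMeasurable (by fun_prop)) ?_ ?_ ?_ ?_
  · intro n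
    filter_upwards [ae_restrict_mem measurableSet_Ioi] with t ht
    obtain ⟨b, hb, hb'⟩ := hreal t n (le_of_lt ht)
    simpa only [hb, Complex.ofReal_re] using hb'
  · filter_upwards [ae_restrict_mem measurableSet_Ioi] with t ht
      using (hbound t (le_of_lt ht)).summable
  · have h := (integrableOn_exp_neg_mul_sub_integratedServiceCdf (s := σ) (b := ρ * (1 - ‖z‖))
      (by
        rw [Complex.re_ofReal_mul, Complex.sub_re, Complex.one_re, Complex.ofReal_re]
        linarith)).const_mul (σ : ℂ)
    refine h.norm.congr ?_
    filter_upwards [ae_restrict_mem measurableSet_Ioi] with t ht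
      using (hbound t (le_of_lt ht)).tsum_eq.symm
  · filter_upwards [ae_restrict_mem measurableSet_Ioi] with t ht using hexp t z (le_of_lt ht)

/-! ### Removing the customers one at a time -/

/-- The time which the observer still spends in the system after the arrival of the first `n`
customers; it is negative if the observer leaves before the `n`-th arrival. -/
def residualTime (X : QueueIndex → Ω → ℝ) (n : ℕ) (ω : Ω) : ℝ :=
  X .observer ω - ∑ j ∈ Finset.range n, X (.interarrival j) ω

/-- The product of a factor `z` for each of the first `n` customers who departs before the observer
does. -/
noncomputable def departureWeight (X : QueueIndex → Ω → ℝ) (z : ℂ) (n : ℕ) (ω : Ω) : ℂ :=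
  ∏ i ∈ Finset.range n, if X (.service i) ω ≤ residualTime X (i + 1) ω then z else 1

theorem residualTime_succ (X : QueueIndex → Ω → ℝ) (n : ℕ) (ω : Ω) :
    residualTime X (n + 1) ω = residualTime X n ω - X (.interarrival n) ω := by
  simp only [residualTime, Finset.sum_range_succ]
  ring

theorem departureTime_le_observer_iff (X : QueueIndex → Ω → ℝ) (i : ℕ) (ω : Ω) :
    departureTime X i ω ≤ X .observer ω ↔ X (.service i) ω ≤ residualTime X (i + 1) ω := by
  simp only [departureTime, arrivalTime, residualTime]
  constructor <;> intro h <;> linarith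

/-- Stated for an arbitrary `MeasurableSpace Ω`, so that it also applies to the σ-algebra generated
by part of the variables. -/
theorem measurable_residualTime [MeasurableSpace Ω] {X : QueueIndex → Ω → ℝ} {n : ℕ}
    (hT : Measurable (X .observer)) (hA : ∀ j < n, Measurable (X (.interarrival j))) :
    Measurable (residualTime X n) :=
  hT.sub (Finset.measurable_fun_sum _ fun j hj => hA j (Finset.mem_range.1 hj))

/-- Stated for an arbitrary `MeasurableSpace Ω`, so that it also applies to the σ-algebra generated
by part of the variables. -/
theorem measurable_departureWeight [MeasurableSpace Ω] {X : QueueIndex → Ω → ℝ} {n : ℕ} (z : ℂ)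
    (hT : Measurable (X .observer)) (hA : ∀ j < n, Measurable (X (.interarrival j)))
    (hS : ∀ j < n, Measurable (X (.service j))) :
    Measurable (departureWeight X z n) := by
  refine Finset.measurable_fun_prod _ fun i hi => ?_
  have hi := Finset.mem_range.1 hi
  exact Measurable.ite (measurableSet_le (hS i hi)
    (measurable_residualTime hT fun j hj => hA j (by omega))) measurable_const measurable_const

theorem norm_departureWeight_le (X : QueueIndex → Ω → ℝ) (z : ℂ) (n : ℕ) (ω : Ω) :
    ‖departureWeight X z n ω‖ ≤ (1 + ‖z‖) ^ n := by
  rw [departureWeight, norm_prod]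
  refine (Finset.prod_le_prod (g := fun _ => 1 + ‖z‖) (fun i _ => norm_nonneg _)
    fun i _ => ?_).trans_eq (by simp)
  split_ifs
  · linarith [norm_nonneg z]
  · simp

theorem norm_departureWeight (X : QueueIndex → Ω → ℝ) (z : ℂ) (n : ℕ) (ω : Ω) :
    (‖departureWeight X z n ω‖ : ℂ) = departureWeight X ‖z‖ n ω := by
  rw [departureWeight, norm_prod, Complex.ofReal_prod]
  refine Finset.prod_congr rfl fun i _ => ?_
  split_ifs <;> simp

/-- The weight of the first `n` customers, on the event that exactly `n` customers arrive while the
observer is in the system, and `0` elsewhere. -/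
noncomputable def exactWeight (X : QueueIndex → Ω → ℝ) (z : ℂ) (n : ℕ) (ω : Ω) : ℂ :=
  open Classical in
  if 0 ≤ residualTime X n ω ∧ residualTime X (n + 1) ω < 0 then departureWeight X z n ω else 0

theorem norm_exactWeight (X : QueueIndex → Ω → ℝ) (z : ℂ) (n : ℕ) (ω : Ω) :
    (‖exactWeight X z n ω‖ : ℂ) = exactWeight X ‖z‖ n ω := by
  unfold exactWeight
  split_ifs
  · exact norm_departureWeight X z n ω
  · simp

theorem measurableSet_exactly_arrivals [MeasurableSpace Ω] {X : QueueIndex → Ω → ℝ}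
    (hX : ∀ j, Measurable (X j)) (n : ℕ) :
    MeasurableSet {ω | 0 ≤ residualTime X n ω ∧ residualTime X (n + 1) ω < 0} :=
  (measurableSet_le measurable_const
    (measurable_residualTime (hX _) fun _ _ => hX _)).inter
    (measurableSet_lt
      (measurable_residualTime (hX _) fun _ _ => hX _) measurable_const)

theorem measurable_iSup_comap {ι : Type*} (X : ι → Ω → ℝ) {i j : ι} (hij : i ≠ j) :
    Measurable[⨆ i ∈ ({j}ᶜ : Set ι), MeasurableSpace.comap (X i) inferInstance] (X i) :=
  Measurable.mono (comap_measurable (X i))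
    (le_iSup₂_of_le (f := fun i (_ : i ∈ ({j}ᶜ : Set ι)) => MeasurableSpace.comap (X i) _) i hij
      le_rfl) le_rfl

section

variable [MeasurableSpace Ω] {P : Measure Ω} [IsProbabilityMeasure P] {ρ σ : ℝ}
  {X : QueueIndex → Ω → ℝ}

/-- Given the past, customer `n` arrives after an exponential time: the interarrival time before
that customer may be integrated out. -/
theorem integral_departureWeight_mul_interarrival (hX : IsObservedMMInfinity P ρ σ X) (z : ℂ)
    (n : ℕ) {f : ℝ → ℝ → ℂ} (hf : Measurable (Function.uncurry f)) {C : ℝ}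
    (hC : ∀ r x, ‖f r x‖ ≤ C) :
    ∫ ω, departureWeight X z n ω * f (residualTime X n ω) (X (.interarrival n) ω) ∂P =
      ∫ ω, departureWeight X z n ω * ∫ x, f (residualTime X n ω) x ∂expMeasure ρ ∂P := by
  have hw : Measurable (departureWeight X z n) := measurable_departureWeight z
    (hX.measurable _) (fun _ _ => hX.measurable _) fun _ _ => hX.measurable _
  have hr : Measurable (residualTime X n) := measurable_residualTime (hX.measurable _)
    fun _ _ => hX.measurable _
  have hind : IndepFun (fun ω => (departureWeight X z n ω, residualTime X n ω))
      (X (.interarrival n)) P := by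
    refine hX.indep.indepFun_of_measurable_iSup_compl hX.measurable _ ?_
    let := ⨆ i ∈ ({.interarrival n}ᶜ : Set QueueIndex),
      MeasurableSpace.comap (X i) inferInstance
    have hT : Measurable (X .observer) := measurable_iSup_comap X (by simp)
    have hA : ∀ j < n, Measurable (X (.interarrival j)) := fun j hj =>
      measurable_iSup_comap X (by simpa using hj.ne)
    have hS : ∀ j < n, Measurable (X (.service j)) := fun j hj =>
      measurable_iSup_comap X (by simp)
    exact (measurable_departureWeight z hT hA hS).prodMk (measurable_residualTime hT hA)
  have h := hind.integral_comp_prodMk (hw.prodMk hr) (hX.measurable _)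
    (f := fun p x => p.1 * f p.2 x) ?_ ?_
  · simp only [h, integral_const_mul, hX.law, queueRate]
  · exact (measurable_fst.comp measurable_fst).mul
      (hf.comp ((measurable_snd.comp measurable_fst).prodMk measurable_snd))
  · refine Integrable.of_bound (C := (1 + ‖z‖) ^ n * C) (Measurable.aestronglyMeasurable
      (hw.mul (hf.comp (hr.prodMk (hX.measurable _))))) (ae_of_all _ fun ω => ?_)
    rw [norm_mul]
    gcongr
    · exact norm_departureWeight_le X z n ω
    · exact hC _ _

/-- The service time of customer `n` may be integrated out against a function of the residual time
at that customer's arrival. -/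
theorem integral_departureWeight_succ_mul (hX : IsObservedMMInfinity P ρ σ X) (z : ℂ)
    (n : ℕ) {g : ℝ → ℂ} (hg : Measurable g) {C : ℝ} (hC : ∀ r, ‖g r‖ ≤ C)
    (hneg : ∀ r < 0, g r = 0) :
    ∫ ω, departureWeight X z (n + 1) ω * g (residualTime X (n + 1) ω) ∂P =
      ∫ ω, departureWeight X z n ω *
        ((1 + (z - 1) * (1 - Real.exp (-residualTime X (n + 1) ω) : ℝ)) *
          g (residualTime X (n + 1) ω)) ∂P := by
  have hw : Measurable (departureWeight X z n) := measurable_departureWeight z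
    (hX.measurable _) (fun _ _ => hX.measurable _) fun _ _ => hX.measurable _
  have hr : Measurable (residualTime X (n + 1)) := measurable_residualTime (hX.measurable _)
    fun _ _ => hX.measurable _
  have hind : IndepFun (fun ω => (departureWeight X z n ω, residualTime X (n + 1) ω))
      (X (.service n)) P := by
    refine hX.indep.indepFun_of_measurable_iSup_compl hX.measurable _ ?_
    let := ⨆ i ∈ ({.service n}ᶜ : Set QueueIndex), MeasurableSpace.comap (X i) inferInstance
    have hT : Measurable (X .observer) := measurable_iSup_comap X (by simp)
    have hA (j : ℕ) : Measurable (X (.interarrival j)) := measurable_iSup_comap X (by simp)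
    have hS : ∀ j < n, Measurable (X (.service j)) := fun j hj =>
      measurable_iSup_comap X (by simpa using hj.ne)
    exact (measurable_departureWeight z hT (fun j _ => hA j) hS).prodMk
      (measurable_residualTime hT fun j _ => hA j)
  have hf : Measurable (Function.uncurry fun (p : ℂ × ℝ) (s : ℝ) =>
      p.1 * (g p.2 * if s ≤ p.2 then z else 1)) := by
    refine Measurable.mul (by fun_prop) (Measurable.mul (by fun_prop) ?_)
    exact Measurable.ite (measurableSet_le (by fun_prop) (by fun_prop)) measurable_const
      measurable_const
  have h := hind.integral_comp_prodMk (hw.prodMk hr) (hX.measurable _)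
    (f := fun p s => p.1 * (g p.2 * if s ≤ p.2 then z else 1)) hf ?_
  · calc ∫ ω, departureWeight X z (n + 1) ω * g (residualTime X (n + 1) ω) ∂P
        = ∫ ω, departureWeight X z n ω * (g (residualTime X (n + 1) ω) *
            if X (.service n) ω ≤ residualTime X (n + 1) ω then z else 1) ∂P := by
          congr 1
          ext ω
          rw [departureWeight, Finset.prod_range_succ, ← departureWeight]
          ring
      _ = _ := by
          rw [h]
          congr 1
          ext ω
          simp only [integral_const_mul, hX.law, queueRate]
          by_cases h0 : 0 ≤ residualTime X (n + 1) ω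
          · rw [integral_expMeasure_ite one_pos h0, one_mul]
            ring
          · simp [hneg _ (not_le.1 h0)]
  · refine Integrable.of_bound (C := (1 + ‖z‖) ^ n * (C * (1 + ‖z‖)))
      (Measurable.aestronglyMeasurable (hf.comp ((hw.prodMk hr).prodMk (hX.measurable _))))
      (ae_of_all _ fun ω => ?_)
    rw [norm_mul, norm_mul]
    have hC0 : 0 ≤ C := (norm_nonneg _).trans (hC 0)
    gcongr
    · exact norm_departureWeight_le X z n ω
    · exact hC _
    · split_ifs
      · linarith [norm_nonneg z]
      · simp

/-- Removing the last of `n + 1` customers, service time first and then interarrival time. -/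
theorem integral_departureWeight_succ_mul_poissonWeight (hρ : 0 < ρ)
    (hX : IsObservedMMInfinity P ρ σ X) (z : ℂ) (n k : ℕ) :
    ∫ ω, departureWeight X z (n + 1) ω * poissonWeight ρ z k (residualTime X (n + 1) ω) ∂P =
      ∫ ω, departureWeight X z n ω * poissonWeight ρ z (k + 1) (residualTime X n ω) ∂P := by
  rw [integral_departureWeight_succ_mul hX z n (measurable_poissonWeight ρ z k)
    (norm_poissonWeight_le hρ z k) fun r hr => if_neg (not_le.2 hr)]
  simp only [residualTime_succ]
  rw [integral_departureWeight_mul_interarrival hX z n (f := fun r x =>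
      (1 + (z - 1) * (1 - Real.exp (-(r - x)) : ℝ)) * poissonWeight ρ z k (r - x))
    (by unfold Function.uncurry; fun_prop) (C := (1 + ‖z - 1‖) * (1 + ‖z‖) ^ k)]
  · simp only [integral_expMeasure_mul_poissonWeight hρ]
  · intro r x
    by_cases h : 0 ≤ r - x
    · have hE := one_sub_exp_neg_mem h
      rw [norm_mul]
      gcongr
      · refine (norm_add_le _ _).trans ?_
        rw [norm_one, norm_mul, Complex.norm_real, Real.norm_of_nonneg hE.1]
        gcongr
        exact mul_le_of_le_one_right (norm_nonneg _) hE.2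
      · exact norm_poissonWeight_le hρ z k _
    · rw [poissonWeight, if_neg h, mul_zero, norm_zero]
      positivity

theorem integral_departureWeight_mul_poissonWeight (hρ : 0 < ρ)
    (hX : IsObservedMMInfinity P ρ σ X) (z : ℂ) (n k : ℕ) :
    ∫ ω, departureWeight X z n ω * poissonWeight ρ z k (residualTime X n ω) ∂P =
      ∫ t, poissonWeight ρ z (n + k) t ∂expMeasure σ := by
  induction n generalizing k with
  | zero =>
    have h := hX.law .observer
    simp only [queueRate] at h
    rw [← h, integral_map (hX.measurable _).aemeasurable
      (measurable_poissonWeight ρ z _).aestronglyMeasurable]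
    simp [departureWeight, residualTime]
  | succ n ih =>
    rw [integral_departureWeight_succ_mul_poissonWeight hρ hX, ih, add_right_comm, add_assoc]

theorem integrable_exactWeight (hX : IsObservedMMInfinity P ρ σ X) (z : ℂ) (n : ℕ) :
    Integrable (exactWeight X z n) P := by
  refine Integrable.of_bound (C := (1 + ‖z‖) ^ n) (Measurable.aestronglyMeasurable ?_)
    (ae_of_all _ fun ω => ?_)
  · exact Measurable.ite (measurableSet_exactly_arrivals hX.measurable n) (measurable_departureWeight z
      (hX.measurable _) (fun _ _ => hX.measurable _) fun _ _ => hX.measurable _) measurable_const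
  · unfold exactWeight
    split_ifs
    · exact norm_departureWeight_le X z n ω
    · rw [norm_zero]; positivity

theorem integral_exactWeight (hρ : 0 < ρ) (hX : IsObservedMMInfinity P ρ σ X) (z : ℂ) (n : ℕ) :
    ∫ ω, exactWeight X z n ω ∂P = ∫ t, poissonWeight ρ z n t ∂expMeasure σ := by
  rw [← add_zero n, ← integral_departureWeight_mul_poissonWeight hρ hX z n 0, add_zero]
  calc ∫ ω, exactWeight X z n ω ∂P
      = ∫ ω, departureWeight X z n ω * (if 0 ≤ residualTime X n ω then
          if X (.interarrival n) ω ≤ residualTime X n ω then 0 else 1 else 0) ∂P := by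
        congr 1
        ext ω
        simp only [exactWeight, residualTime_succ, sub_neg]
        grind
    _ = _ := by
        -- The probability of no arrival during the residual time `r` is `poissonWeight ρ z 0 r`.
        rw [integral_departureWeight_mul_interarrival hX z n
          (f := fun r x => if 0 ≤ r then if x ≤ r then 0 else 1 else 0) (C := 1)]
        · congr 1
          ext ω
          congr 1
          by_cases h : 0 ≤ residualTime X n ω
          · simp only [h, if_true, poissonWeight]
            rw [integral_expMeasure_ite hρ h]
            simp
          · simp [h, poissonWeight]
        · exact Measurable.ite (measurableSet_le measurable_const measurable_fst)
            (Measurable.ite (measurableSet_le measurable_snd measurable_fst) measurable_const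
              measurable_const) measurable_const
        · intro r x
          split_ifs <;> simp

end

/-! ### Finiteness and the generating function -/

theorem ae_nonneg [MeasurableSpace Ω] {P : Measure Ω} {ρ σ : ℝ} {X : QueueIndex → Ω → ℝ}
    (hX : IsObservedMMInfinity P ρ σ X) : ∀ᵐ ω ∂P, ∀ j, 0 ≤ X j ω := by
  have : Countable QueueIndex := by
    refine Function.Injective.countable (β := ℕ ⊕ ℕ ⊕ Unit) (f := fun
      | .interarrival i => .inl i
      | .service i => .inr (.inl i)
      | .observer => .inr (.inr ())) ?_
    rintro (i | i | _) (j | j | _) <;> simp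
  rw [ae_all_iff]
  intro j
  have h := ae_nonneg_expMeasure (queueRate ρ σ j)
  rw [← hX.law j] at h
  exact ae_of_ae_map (hX.measurable j).aemeasurable h

theorem antitone_residualTime {X : QueueIndex → Ω → ℝ} {ω : Ω} (h : ∀ j, 0 ≤ X j ω) :
    Antitone fun n => residualTime X n ω :=
  antitone_nat_of_succ_le fun n => by rw [residualTime_succ]; linarith [h (.interarrival n)]

open Classical in
/-- A customer arriving after the observer has left cannot depart before that, services being
nonnegative. -/
theorem departedBy_observer_eq {X : QueueIndex → Ω → ℝ} {ω : Ω} (h : ∀ j, 0 ≤ X j ω) {n : ℕ}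
    (hn : residualTime X (n + 1) ω < 0) :
    departedBy X (X .observer ω) ω =
      {i ∈ Finset.range n | X (.service i) ω ≤ residualTime X (i + 1) ω} := by
  ext i
  simp only [departedBy, Set.mem_ofPred_eq, departureTime_le_observer_iff, Finset.coe_filter,
    Finset.mem_range, iff_and_self]
  intro hi
  by_contra hni
  have := antitone_residualTime h (Nat.succ_le_succ (not_lt.1 hni))
  linarith [h (.service i), this]

theorem departureWeight_eq_pow {X : QueueIndex → Ω → ℝ} {ω : Ω} (h : ∀ j, 0 ≤ X j ω) {n : ℕ}
    (hn : residualTime X (n + 1) ω < 0) (z : ℂ) :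
    departureWeight X z n ω = z ^ observedDepartures X ω := by
  classical
  rw [observedDepartures, numDepartures, departedBy_observer_eq h hn, Set.ncard_coe_finset,
    departureWeight, Finset.prod_ite]
  simp

/-- The events of exactly `m` arrivals are disjoint, so only one term of the series is nonzero. -/
theorem hasSum_exactWeight {X : QueueIndex → Ω → ℝ} {ω : Ω} (h : ∀ j, 0 ≤ X j ω) {n : ℕ}
    (hn : 0 ≤ residualTime X n ω ∧ residualTime X (n + 1) ω < 0) (z : ℂ) :
    HasSum (fun m => exactWeight X z m ω) (z ^ observedDepartures X ω) := by
  have hval : exactWeight X z n ω = z ^ observedDepartures X ω := by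
    rw [exactWeight, if_pos hn, departureWeight_eq_pow h hn.2]
  rw [← hval]
  refine hasSum_single n fun m hm => if_neg fun hm' => ?_
  rcases hm.lt_or_gt with hlt | hlt
  · have := antitone_residualTime h (Nat.succ_le_of_lt hlt)
    linarith [hn.1, hm'.2, this]
  · have := antitone_residualTime h (Nat.succ_le_of_lt hlt)
    linarith [hn.2, hm'.1, this]

section

variable [MeasurableSpace Ω] {P : Measure Ω} [IsProbabilityMeasure P] {ρ σ : ℝ}
  {X : QueueIndex → Ω → ℝ}

theorem hasSum_integral_exactWeight (hρ : 0 < ρ) (hσ : 0 < σ) (hX : IsObservedMMInfinity P ρ σ X)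
    {z : ℂ} (hz : ρ * ‖z‖ < σ + ρ) :
    HasSum (fun n => ∫ ω, exactWeight X z n ω ∂P) (σ * ∫ t : ℝ in Set.Ioi 0,
      Complex.exp (-(σ * t) - ρ * (1 - z) * integratedServiceCdf t)) := by
  simp only [integral_exactWeight hρ hX]
  exact hasSum_integral_poissonWeight hρ hσ hz

theorem summable_integral_norm_exactWeight (hρ : 0 < ρ) (hσ : 0 < σ)
    (hX : IsObservedMMInfinity P ρ σ X) {z : ℂ} (hz : ρ * ‖z‖ < σ + ρ) :
    Summable fun n => ∫ ω, ‖exactWeight X z n ω‖ ∂P := by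
  rw [← Complex.summable_ofReal]
  simp only [← integral_complex_ofReal, norm_exactWeight]
  exact (hasSum_integral_exactWeight hρ hσ hX (by simpa using hz)).summable

/-- With probability one, only finitely many customers arrive while the observer is in the system:
the probabilities that there are exactly `n` of them sum to one. -/
theorem ae_exists_exactly_arrivals (hρ : 0 < ρ) (hσ : 0 < σ) (hX : IsObservedMMInfinity P ρ σ X) :
    ∀ᵐ ω ∂P, ∃ n, 0 ≤ residualTime X n ω ∧ residualTime X (n + 1) ω < 0 := by
  set S : ℕ → Set Ω := fun n => {ω | 0 ≤ residualTime X n ω ∧ residualTime X (n + 1) ω < 0} with hS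
  have hmeas (n : ℕ) : MeasurableSet (S n) := measurableSet_exactly_arrivals hX.measurable n
  have hone : HasSum (fun n => P.real (S n)) 1 := by
    have h := hasSum_integral_exactWeight hρ hσ hX (z := 1) (by simpa using hσ)
    rw [← Complex.hasSum_ofReal]
    convert! h using 1
    · ext n
      have : exactWeight X 1 n = (S n).indicator fun _ => 1 := by
        ext ω
        simp [exactWeight, departureWeight, hS, Set.indicator_apply]
      rw [this, integral_indicator_const _ (hmeas n)]
      simp
    · have := integral_exp_mul_complex_Ioi (a := -(σ : ℂ)) (by simpa using hσ) 0
      have hσ' : (σ : ℂ) ≠ 0 := by exact_mod_cast hσ.ne'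
      simp only [sub_self, mul_zero, zero_mul, sub_zero, ← neg_mul, this]
      simp [hσ']
  have hdisj : Pairwise (Function.onFun (AEDisjoint P) S) := by
    have key {m n : ℕ} (hmn : m < n) : AEDisjoint P (S m) (S n) := by
      refine measure_mono_null ?_ (ae_iff.1 (ae_nonneg hX))
      rintro ω ⟨hm, hn⟩ h
      have := antitone_residualTime h (Nat.succ_le_of_lt hmn)
      linarith [hm.2, hn.1, this]
    intro m n hmn
    rcases hmn.lt_or_gt with h | h
    · exact key h
    · exact (key h).symm
  have hP : P (⋃ n, S n) = 1 := by
    rw [measure_iUnion₀ hdisj fun n => (hmeas n).nullMeasurableSet]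
    calc ∑' n, P (S n) = ∑' n, ENNReal.ofReal (P.real (S n)) := by simp
      _ = ENNReal.ofReal (∑' n, P.real (S n)) :=
          (ENNReal.ofReal_tsum_of_nonneg (fun n => measureReal_nonneg) hone.summable).symm
      _ = 1 := by rw [hone.tsum_eq]; simp
  filter_upwards [(mem_ae_iff_prob_eq_one (MeasurableSet.iUnion hmeas)).2 hP] with ω hω
  simpa [hS] using hω

end

theorem mainTheorem2 {Ω : Type*} [MeasurableSpace Ω] (P : Measure Ω) [IsProbabilityMeasure P]
    (ρ σ : ℝ) (hρ : 0 < ρ) (hσ : 0 < σ) (X : QueueIndex → Ω → ℝ)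
    (hX : IsObservedMMInfinity P ρ σ X) :
    (∀ᵐ ω ∂P, (departedBy X (X .observer ω) ω).Finite) ∧
    ∀ z : ℂ, ρ * ‖z‖ < σ + ρ →
      Integrable (fun ω => z ^ observedDepartures X ω) P ∧
      HasSum (fun n : ℕ => (σ : ℂ) *
          (((σ + n : ℂ) ^ n * Complex.exp (-(σ + n : ℂ)) / (n.factorial : ℂ)) *
            (1 / (σ + ρ + n - ρ * z))))
        (∫ ω, z ^ observedDepartures X ω ∂P) ∧
      ∫ ω, z ^ observedDepartures X ω ∂P =
        σ / (σ + ρ * (1 - z)) * kummerPhi 1 (σ + ρ * (1 - z) + 1) (ρ * (1 - z)) := by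
  refine ⟨?_, fun z hz => ?_⟩
  · filter_upwards [ae_nonneg hX, ae_exists_exactly_arrivals hρ hσ hX] with ω h ⟨n, hn⟩
    rw [departedBy_observer_eq h hn.2]
    exact Finset.finite_toSet _
  · have hae : ∀ᵐ ω ∂P, HasSum (fun n => exactWeight X z n ω) (z ^ observedDepartures X ω) := by
      filter_upwards [ae_nonneg hX, ae_exists_exactly_arrivals hρ hσ hX] with ω h ⟨n, hn⟩
      exact hasSum_exactWeight h hn z
    obtain ⟨hint, hsum⟩ := integrable_and_hasSum_integral (integrable_exactWeight hX z)
      (summable_integral_norm_exactWeight hρ hσ hX hz) hae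
    have hI := hsum.unique (hasSum_integral_exactWeight hρ hσ hX hz)
    have ha : 0 < σ + (ρ * (1 - z) : ℂ).re := by
      rw [Complex.re_ofReal_mul, Complex.sub_re, Complex.one_re]
      have := mul_le_mul_of_nonneg_left (Complex.re_le_norm z) hρ.le
      linarith
    refine ⟨hint, ?_, ?_⟩
    · rw [hI]
      refine ((hasSum_integral_exp_eq_abel hσ ha).mul_left (σ : ℂ)).congr_fun fun n => ?_
      ring_nf
    · rw [hI, integral_exp_eq_kummerPhi ha]
      ring
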